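/- Let $n\ge 2$ and let $0<k_1\le k_2\le\dots\le k_n$ be real numbers. Consider the weighted star graph on the nodes $0,1,\dots,n$, in which the centre $0$ is linked to each leaf $i\in\{1,\dots,n\}$ with weight $k_i$ and there are no other links; thus $k_i$ is the degree of leaf $i$. Let $Q$ be its Laplacian matrix (weighted degrees on the diagonal, minus the link weights off the diagonal), $Q^\dagger$ the Moore–Penrose pseudoinverse of $Q$, and $\omega_{ij}=(e_i-e_j)^TQ^\dagger(e_i-e_j)$ the effective resistances, with matrix $\Omega=(\omega_{ij})$. For a probability vector $\mathbf p$ on the nodes put $\operatorname{var}_\omega(\mathbf p)=\tfrac12\mathbf p^T\Omega\mathbf p$. For $1\le\ell\le n$ put $S_\ell=\sum_{i=1}^{\ell}k_i$ and $T_\ell=(\ell-2)^{-1}S_\ell$, with $T_2=+\infty$. Below, an inequality involving $k_{n+1}$ is regarded as satisfied. There is a unique probability vector $\mathbf p^\star$ maximizing $\operatorname{var}_\omega$ over all probability vectors on the nodes. Let $\mathcal V^\star=\{i:p^\star_i>0\}$ be its support (the maximum variance support). 1. There is a unique $\ell\in\{1,\dots,n\}$ with $$k_\ell<T_\ell\le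 k_{\ell+1},$$ and for this $\ell$ the maximum variance support consists of the $\ell$ leaves of smallest degree, $\mathcal V^\star=\{1,\dots,\ell\}$, and $$p^\star_i=\frac12-\frac{(\ell-2)k_i}{2S_\ell}\quad(1\le i\le\ell),\qquad p^\star_i=0\ \text{ at all other nodes}.$$ 2. There is also a unique $\ell\in\{1,\dots,n\}$ with $$k_\ell\le T_\ell<k_{\ell+1}.$$ For this $\ell$ too, $p^\star_i=\frac12-\frac{(\ell-2)k_i}{2S_\ell}$ for $1\le i\le\ell$ and $p^\star_i=0$ at all other nodes; and $\mathcal V^\star=\{1,\dots,\ell\}$ if and only if $k_\ell\ne T_\ell$. -/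

import Mathlib

open scoped Matrix

/-- A finite weighted graph on the node set `V`, given by its symmetric link weights;
`weight i j = 0` means that there is no link between `i` and `j`. -/
structure WeightedGraph (V : Type*) where
  weight : V → V → ℝ
  symm : ∀ i j, weight i j = weight j i
  nonneg : ∀ i j, 0 ≤ weight i j
  loopless : ∀ i, weight i i = 0

/-- `X` is the Moore–Penrose pseudoinverse of the real matrix `A` (the four Penrose equations). -/
structure IsMoorePenroseInverse {V : Type*} [Fintype V] (A X : Matrix V V ℝ) : Prop where
  mul_mul_self : A * X * A = A
  self_mul_mul : X * A * X = X
  symm_mul : (A * X)ᵀ = A * X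
  mul_symm : (X * A)ᵀ = X * A

theorem IsMoorePenroseInverse.unique {V : Type*} [Fintype V] {A X Y : Matrix V V ℝ}
    (hX : IsMoorePenroseInverse A X) (hY : IsMoorePenroseInverse A Y) : X = Y := by
  have h1 : A * X = A * Y := by
    calc A * X = (A * X)ᵀ := hX.symm_mul.symm
      _ = (A * Y * (A * X))ᵀ := by rw [← Matrix.mul_assoc, hY.mul_mul_self]
      _ = A * X * (A * Y) := by rw [Matrix.transpose_mul, hX.symm_mul, hY.symm_mul]
      _ = A * Y := by rw [← Matrix.mul_assoc, hX.mul_mul_self]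
  have h2 : X * A = Y * A := by
    calc X * A = X * A * (Y * A) := by
          rw [Matrix.mul_assoc X A, ← Matrix.mul_assoc A Y A, hY.mul_mul_self]
      _ = (Y * A * (X * A))ᵀ := by rw [Matrix.transpose_mul, hX.mul_symm, hY.mul_symm]
      _ = (Y * A)ᵀ := by rw [Matrix.mul_assoc Y A, ← Matrix.mul_assoc A X A, hX.mul_mul_self]
      _ = Y * A := hY.mul_symm
  calc X = X * A * X := hX.self_mul_mul.symm
    _ = Y * A * Y := by rw [h2, Matrix.mul_assoc, h1, ← Matrix.mul_assoc]
    _ = Y := hY.self_mul_mul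

theorem exists_isMoorePenroseInverse {V : Type*} [Fintype V] {A : Matrix V V ℝ}
    (hA : Aᵀ = A) : ∃ X, IsMoorePenroseInverse A X := by
  classical
  have hH : A.IsHermitian := by
    rw [Matrix.IsHermitian, Matrix.conjTranspose_eq_transpose_of_trivial, hA]
  set U : Matrix V V ℝ := hH.eigenvectorUnitary.1 with hU
  have hUU : Uᵀ * U = 1 := by
    have := Matrix.UnitaryGroup.star_mul_self hH.eigenvectorUnitary
    rwa [Matrix.star_eq_conjTranspose, Matrix.conjTranspose_eq_transpose_of_trivial] at this
  have hdiag : A = U * Matrix.diagonal hH.eigenvalues * Uᵀ := by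
    have := hH.spectral_theorem
    rw [Unitary.conjStarAlgAut_apply] at this
    rw [← Matrix.conjTranspose_eq_transpose_of_trivial U, ← Matrix.star_eq_conjTranspose]
    exact this
  set d := hH.eigenvalues
  have key : ∀ a b : V → ℝ, U * Matrix.diagonal a * Uᵀ * (U * Matrix.diagonal b * Uᵀ)
      = U * Matrix.diagonal (fun i => a i * b i) * Uᵀ := by
    intro a b
    calc _ = U * Matrix.diagonal a * (Uᵀ * U) * Matrix.diagonal b * Uᵀ := by
          simp only [Matrix.mul_assoc]
      _ = _ := by rw [hUU, Matrix.mul_one, Matrix.mul_assoc U, Matrix.diagonal_mul_diagonal]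
  have keyT : ∀ a : V → ℝ, (U * Matrix.diagonal a * Uᵀ)ᵀ = U * Matrix.diagonal a * Uᵀ := by
    intro a
    simp [Matrix.transpose_mul, Matrix.mul_assoc]
  refine ⟨U * Matrix.diagonal (fun i => (d i)⁻¹) * Uᵀ, ?_, ?_, ?_, ?_⟩
  · rw [hdiag, key, key]; simp [mul_inv_mul_cancel]
  · rw [hdiag, key, key]; congr; ext i; simpa using mul_inv_mul_cancel (d i)⁻¹
  · rw [hdiag, key, keyT]
  · rw [hdiag, key, keyT]

open Classical in
/-- The Moore–Penrose pseudoinverse. For symmetric matrices the default value is never used, by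
`exists_isMoorePenroseInverse`. -/
noncomputable def moorePenrose {V : Type*} [Fintype V] (A : Matrix V V ℝ) : Matrix V V ℝ :=
  if h : ∃ X, IsMoorePenroseInverse A X then h.choose else 0

namespace WeightedGraph

variable {V : Type*} [Fintype V]

/-- The weighted degree of a node. -/
def degree (G : WeightedGraph V) (i : V) : ℝ := ∑ j, G.weight i j

/-- The Laplacian matrix: degrees on the diagonal, minus the link weights off the diagonal. -/
def laplacian [DecidableEq V] (G : WeightedGraph V) : Matrix V V ℝ :=
  Matrix.of fun i j => if i = j then G.degree i else -G.weight i j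

/-- The effective resistance between the nodes `i` and `j` (of a connected graph). -/
noncomputable def resistance [DecidableEq V] (G : WeightedGraph V) (i j : V) : ℝ :=
  (Pi.single i 1 - Pi.single j 1) ⬝ᵥ
    (moorePenrose G.laplacian *ᵥ (Pi.single i 1 - Pi.single j 1))

/-- The matrix of effective resistances. -/
noncomputable def resistanceMatrix [DecidableEq V] (G : WeightedGraph V) : Matrix V V ℝ :=
  Matrix.of G.resistance

/-- The variance of a distribution with respect to the square root of the effective resistance. -/
noncomputable def variance [DecidableEq V] (G : WeightedGraph V) (p : V → ℝ) : ℝ :=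
  1 / 2 * (p ⬝ᵥ (G.resistanceMatrix *ᵥ p))

/-- `p` is a distribution of maximum variance among all distributions on the nodes of `G`. -/
def IsMaxVariance [DecidableEq V] (G : WeightedGraph V) (p : V → ℝ) : Prop :=
  p ∈ stdSimplex ℝ V ∧ ∀ q ∈ stdSimplex ℝ V, G.variance q ≤ G.variance p

end WeightedGraph

/-- The weighted star with centre `0` and leaves `1, …, n`; the leaf `i.succ` is linked to the
centre with weight `k i` and hence has degree `k i`. -/
def weightedStar {n : ℕ} (k : Fin n → ℝ) (hk : ∀ i, 0 < k i) : WeightedGraph (Fin (n + 1)) where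
  weight := Fin.cons (Fin.cons 0 k) (fun i => Fin.cons (k i) (fun _ => 0))
  symm i j := by
    cases i using Fin.cases <;> cases j using Fin.cases <;> simp
  nonneg i j := by
    cases i using Fin.cases <;> cases j using Fin.cases <;> simp [(hk _).le]
  loopless i := by
    cases i using Fin.cases <;> simp

/-- The support of a distribution. -/
def distSupport {V : Type*} (p : V → ℝ) : Set V := {i | 0 < p i}

/-- The first `ℓ` leaves `1, …, ℓ` of a star with centre `0` (those of smallest degree when the
degrees are increasing). -/
def firstLeaves (n ℓ : ℕ) : Set (Fin (n + 1)) := {x | 1 ≤ (x : ℕ) ∧ (x : ℕ) ≤ ℓ}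

/-- The sum `k₁ + ⋯ + k_ℓ`; the entry `k i` with `i : Fin n` is the degree of leaf number
`i + 1`. -/
def partialSum {n : ℕ} (k : Fin n → ℝ) (ℓ : ℕ) : ℝ := ∑ i ∈ Finset.univ.filter (fun i : Fin n => (i : ℕ) < ℓ), k i

/-- The quantity `(ℓ - 2)⁻¹ (k₁ + ⋯ + k_ℓ)`, read as `+∞` for `ℓ = 2`. -/
noncomputable def threshold {n : ℕ} (k : Fin n → ℝ) (ℓ : ℕ) : EReal :=
  if ℓ = 2 then ⊤ else ((((ℓ : ℝ) - 2)⁻¹ * partialSum k ℓ : ℝ) : EReal)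

/-- `1 ≤ ℓ ≤ n` and `k_ℓ < (ℓ - 2)⁻¹ (k₁ + ⋯ + k_ℓ) ≤ k_{ℓ+1}`, where the second inequality is
void for `ℓ = n`. -/
def IsSupportIndex {n : ℕ} (k : Fin n → ℝ) (ℓ : ℕ) : Prop :=
  1 ≤ ℓ ∧ ℓ ≤ n ∧
    (∀ i : Fin n, (i : ℕ) + 1 = ℓ → (k i : EReal) < threshold k ℓ) ∧
    (∀ i : Fin n, (i : ℕ) = ℓ → threshold k ℓ ≤ (k i : EReal))

/-- `1 ≤ ℓ ≤ n` and `k_ℓ ≤ (ℓ - 2)⁻¹ (k₁ + ⋯ + k_ℓ) < k_{ℓ+1}`, where the second inequality is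
void for `ℓ = n`. -/
def IsWeakSupportIndex {n : ℕ} (k : Fin n → ℝ) (ℓ : ℕ) : Prop :=
  1 ≤ ℓ ∧ ℓ ≤ n ∧
    (∀ i : Fin n, (i : ℕ) + 1 = ℓ → (k i : EReal) ≤ threshold k ℓ) ∧
    (∀ i : Fin n, (i : ℕ) = ℓ → threshold k ℓ < (k i : EReal))

/-- The vector with entry `1/2 - (ℓ - 2) k_i / (2 (k₁ + ⋯ + k_ℓ))` at the leaves `i = 1, …, ℓ` and
`0` at the centre and at all other leaves. -/
noncomputable def starDistribution {n : ℕ} (k : Fin n → ℝ) (ℓ : ℕ) : Fin (n + 1) → ℝ :=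
  Fin.cons 0 fun i =>
    if (i : ℕ) < ℓ then 1 / 2 - ((ℓ : ℝ) - 2) * k i / (2 * partialSum k ℓ) else 0

/-!
On the star, the resistance between distinct nodes `i ≠ j` is `rᵢ + rⱼ`, where `rᵢ = 1 / kᵢ` is the
resistance between `i` and the centre and `r₀ = 0`. Hence the variance of a distribution `p` is the
concave function `∑ rᵢ pᵢ (1 - pᵢ)`, and its maximizer is the only point satisfying the
Karush–Kuhn–Tucker conditions `rᵢ (1 - 2 pᵢ) ≤ c`, with equality where `pᵢ ≠ 0`. Their solution is
`pᵢ = max 0 (1 - c kᵢ) / 2` on the leaves and `p₀ = 0` at the centre, where the multiplier `c ≥ 0`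
is fixed by the normalization `∑ pᵢ = 1`. As the `kᵢ` increase, `{i | c kᵢ < 1}` and
`{i | c kᵢ ≤ 1}` are initial segments. If `ℓ` is the length of either of them, the normalization
reads `ℓ - c S_ℓ = 2`, so that `c = 1 / T_ℓ`, and the inequalities defining the corresponding index
say that leaf `ℓ` is in the segment and leaf `ℓ + 1` is not.
-/

theorem eq_of_sum_eq_of_subsingleton_ne {ι M : Type*} [Fintype ι] [AddCommGroup M] {p q : ι → M}
    (hsum : ∑ i, q i = ∑ i, p i) (hne : {i | q i ≠ p i}.Subsingleton) : q = p := by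
  ext i
  by_contra hi
  have hsingle : ∑ j, (q j - p j) = q i - p i :=
    Finset.sum_eq_single i
      (fun j _ hji => by_contra fun hj => hji (hne (sub_ne_zero.1 hj) hi)) (by simp)
  rw [Finset.sum_sub_distrib, hsum, sub_self] at hsingle
  exact hi (sub_eq_zero.1 hsingle.symm)

theorem existsUnique_forall_val_lt_iff_mem {n : ℕ} {s : Set (Fin n)} (hs : IsLowerSet s) :
    ∃! ℓ : ℕ, ℓ ≤ n ∧ ∀ i : Fin n, (i : ℕ) < ℓ ↔ i ∈ s := by
  refine existsUnique_of_exists_of_unique ?_ ?_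
  · obtain rfl | ⟨a, rfl⟩ := hs.eq_univ_or_Iio
    · exact ⟨n, le_rfl, fun i => iff_of_true i.2 trivial⟩
    · exact ⟨a, a.2.le, fun _ => Iff.rfl⟩
  · intro ℓ m ⟨hℓn, hℓ⟩ ⟨hmn, hm⟩
    refine le_antisymm ?_ ?_ <;> by_contra! hlt
    · exact lt_irrefl m ((hm ⟨m, by lia⟩).2 ((hℓ ⟨m, by lia⟩).1 hlt))
    · exact lt_irrefl ℓ ((hℓ ⟨ℓ, by lia⟩).2 ((hm ⟨ℓ, by lia⟩).1 hlt))

theorem isMoorePenroseInverse_moorePenrose {V : Type*} [Fintype V] {A : Matrix V V ℝ}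
    (hA : Aᵀ = A) : IsMoorePenroseInverse A (moorePenrose A) := by
  have h := exists_isMoorePenroseInverse hA
  rw [moorePenrose, dif_pos h]
  exact h.choose_spec

theorem dotProduct_moorePenrose_mulVec_self {V : Type*} [Fintype V] {A : Matrix V V ℝ}
    (hA : Aᵀ = A) {u b : V → ℝ} (hu : A *ᵥ u = b) : b ⬝ᵥ (moorePenrose A *ᵥ b) = u ⬝ᵥ b := by
  subst hu
  calc (A *ᵥ u) ⬝ᵥ (moorePenrose A *ᵥ (A *ᵥ u))
      = u ⬝ᵥ ((A * moorePenrose A * A) *ᵥ u) := by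
        rw [Matrix.mulVec_mulVec, ← Matrix.vecMul_transpose, hA, ← Matrix.dotProduct_mulVec,
          Matrix.mulVec_mulVec, Matrix.mul_assoc]
    _ = u ⬝ᵥ (A *ᵥ u) := by rw [(isMoorePenroseInverse_moorePenrose hA).mul_mul_self]

section WeightedGiniSimpson

variable {ι : Type*} [Fintype ι] {r p q : ι → ℝ} {c : ℝ}

/-- The Gini–Simpson index `∑ pᵢ (1 - pᵢ)` of `p`, with weights `r`. The variance of a distribution
on a star has this form. -/
def weightedGiniSimpson (r p : ι → ℝ) : ℝ := ∑ i, r i * (p i * (1 - p i))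

/-- The distribution `p` satisfies the Karush–Kuhn–Tucker conditions for maximizing
`weightedGiniSimpson r` over the simplex. Here `c` is the multiplier of the constraint `∑ pᵢ = 1`;
the multipliers of the constraints `0 ≤ pᵢ` are the slacks in `gradient_le`. -/
structure IsKKTPoint (r p : ι → ℝ) (c : ℝ) : Prop where
  mem_stdSimplex : p ∈ stdSimplex ℝ ι
  gradient_le : ∀ i, r i * (1 - 2 * p i) ≤ c
  gradient_eq : ∀ i, p i ≠ 0 → r i * (1 - 2 * p i) = c

theorem weightedGiniSimpson_add_sum_mul_sq_sub (r p q : ι → ℝ) :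
    weightedGiniSimpson r q + ∑ i, r i * (q i - p i) ^ 2
      = weightedGiniSimpson r p + ∑ i, r i * (1 - 2 * p i) * (q i - p i) := by
  simp only [weightedGiniSimpson, ← Finset.sum_add_distrib]
  exact Finset.sum_congr rfl fun i _ => by ring

theorem IsKKTPoint.sum_gradient_mul_sub_nonpos (hp : IsKKTPoint r p c)
    (hq : q ∈ stdSimplex ℝ ι) : ∑ i, r i * (1 - 2 * p i) * (q i - p i) ≤ 0 := by
  have hterm (i : ι) : r i * (1 - 2 * p i) * (q i - p i) ≤ c * (q i - p i) := by
    by_cases hi : p i = 0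
    · simpa [hi] using mul_le_mul_of_nonneg_right (hp.gradient_le i) (hq.1 i)
    · rw [hp.gradient_eq i hi]
  calc ∑ i, r i * (1 - 2 * p i) * (q i - p i) ≤ ∑ i, c * (q i - p i) :=
        Finset.sum_le_sum fun i _ => hterm i
    _ = 0 := by
        rw [← Finset.mul_sum, Finset.sum_sub_distrib, hq.2, hp.mem_stdSimplex.2, sub_self, mul_zero]

theorem IsKKTPoint.weightedGiniSimpson_add_le (hp : IsKKTPoint r p c)
    (hq : q ∈ stdSimplex ℝ ι) :
    weightedGiniSimpson r q + ∑ i, r i * (q i - p i) ^ 2 ≤ weightedGiniSimpson r p := by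
  linarith [weightedGiniSimpson_add_sum_mul_sq_sub r p q, hp.sum_gradient_mul_sub_nonpos hq]

theorem IsKKTPoint.isMaxOn_weightedGiniSimpson_iff (hp : IsKKTPoint r p c) (hr : 0 ≤ r)
    (hzero : {i | r i = 0}.Subsingleton) :
    q ∈ stdSimplex ℝ ι ∧ IsMaxOn (weightedGiniSimpson r) (stdSimplex ℝ ι) q ↔ q = p := by
  have hsq (q : ι → ℝ) (i : ι) : 0 ≤ r i * (q i - p i) ^ 2 := mul_nonneg (hr i) (sq_nonneg _)
  constructor
  · rintro ⟨hq, hmax⟩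
    have hsum : ∑ i, r i * (q i - p i) ^ 2 = 0 := by
      have hle : weightedGiniSimpson r p ≤ weightedGiniSimpson r q := hmax hp.mem_stdSimplex
      exact le_antisymm (by linarith [hp.weightedGiniSimpson_add_le hq])
        (Finset.sum_nonneg fun i _ => hsq q i)
    rw [Finset.sum_eq_zero_iff_of_nonneg fun i _ => hsq q i] at hsum
    refine eq_of_sum_eq_of_subsingleton_ne (hq.2.trans hp.mem_stdSimplex.2.symm)
      (hzero.anti fun i hi => ?_)
    exact (mul_eq_zero.1 (hsum i (Finset.mem_univ i))).resolve_right
      (pow_ne_zero 2 (sub_ne_zero.2 hi))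
  · rintro rfl
    refine ⟨hp.mem_stdSimplex, isMaxOn_iff.2 fun q' hq' => ?_⟩
    have hsum := Finset.sum_nonneg fun i (_ : i ∈ Finset.univ) => hsq q' i
    linarith [hp.weightedGiniSimpson_add_le hq']

end WeightedGiniSimpson

namespace WeightedGraph

variable {V : Type*} [Fintype V] [DecidableEq V] (G : WeightedGraph V)

theorem transpose_laplacian : G.laplacianᵀ = G.laplacian := by
  ext i j
  by_cases h : i = j
  · rw [h, Matrix.transpose_apply]
  · simp [laplacian, h, Ne.symm h, G.symm i j]

/-- The potential `u` drives a unit current from `i` to `j`. -/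
theorem resistance_eq_sub_of_laplacian_mulVec {i j : V} {u : V → ℝ}
    (hu : G.laplacian *ᵥ u = Pi.single i 1 - Pi.single j 1) : G.resistance i j = u i - u j := by
  rw [resistance, dotProduct_moorePenrose_mulVec_self G.transpose_laplacian hu, dotProduct_sub,
    dotProduct_single_one, dotProduct_single_one]

theorem resistance_self (i : V) : G.resistance i i = 0 := by
  simp [resistance]

variable {G} {r : V → ℝ}

theorem resistanceMatrix_eq_of_resistance_eq_add
    (hr : ∀ i j, i ≠ j → G.resistance i j = r i + r j) :
    G.resistanceMatrix
      = Matrix.vecMulVec r 1 + Matrix.vecMulVec 1 r - Matrix.diagonal (2 * r) := by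
  ext i j
  by_cases h : i = j
  · subst h
    simp [resistanceMatrix, resistance_self, two_mul]
  · simp [resistanceMatrix, hr i j h, h]

theorem variance_eq_weightedGiniSimpson (hr : ∀ i j, i ≠ j → G.resistance i j = r i + r j)
    {p : V → ℝ} (hp : ∑ i, p i = 1) : G.variance p = weightedGiniSimpson r p := by
  have hone : (1 : V → ℝ) ⬝ᵥ p = 1 := by rw [one_dotProduct, hp]
  have hdiag : p ⬝ᵥ (Matrix.diagonal (2 * r) *ᵥ p) = 2 * ∑ i, r i * (p i * p i) := by
    simp only [dotProduct, Matrix.mulVec_diagonal, Pi.mul_apply, Pi.ofNat_apply, Finset.mul_sum]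
    exact Finset.sum_congr rfl fun i _ => by ring
  have hquad : p ⬝ᵥ (G.resistanceMatrix *ᵥ p)
      = 2 * ∑ i, r i * p i - 2 * ∑ i, r i * (p i * p i) := by
    rw [resistanceMatrix_eq_of_resistance_eq_add hr, Matrix.sub_mulVec, Matrix.add_mulVec,
      dotProduct_sub, dotProduct_add, hdiag, Matrix.vecMulVec_mulVec, Matrix.vecMulVec_mulVec,
      hone, dotProduct_comm p, dotProduct_comm p, op_smul_eq_smul, op_smul_eq_smul, one_smul,
      smul_dotProduct, hone, smul_eq_mul, mul_one, ← two_mul, dotProduct]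
  rw [variance, hquad, weightedGiniSimpson, ← mul_sub, ← mul_assoc, ← Finset.sum_sub_distrib]
  norm_num [mul_sub]

theorem isMaxVariance_iff_isMaxOn_weightedGiniSimpson
    (hr : ∀ i j, i ≠ j → G.resistance i j = r i + r j) {p : V → ℝ} :
    G.IsMaxVariance p
      ↔ p ∈ stdSimplex ℝ V ∧ IsMaxOn (weightedGiniSimpson r) (stdSimplex ℝ V) p := by
  refine and_congr_right fun hp => ?_
  rw [isMaxOn_iff]
  exact forall₂_congr fun q hq => by
    rw [variance_eq_weightedGiniSimpson hr hq.2, variance_eq_weightedGiniSimpson hr hp.2]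

end WeightedGraph

section WaterFilling

variable {ι : Type*} {k : ι → ℝ} {c d : ℝ}

/-- The solution of the Karush–Kuhn–Tucker conditions on the leaves of a star with link weights `k`,
for the multiplier `c`. -/
noncomputable def waterFilling (k : ι → ℝ) (c : ℝ) (i : ι) : ℝ := max 0 (1 - c * k i) / 2

theorem waterFilling_nonneg (k : ι → ℝ) (c : ℝ) (i : ι) : 0 ≤ waterFilling k c i :=
  div_nonneg (le_max_left _ _) zero_le_two

theorem waterFilling_pos_iff {i : ι} : 0 < waterFilling k c i ↔ c * k i < 1 := by
  simp [waterFilling]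

theorem waterFilling_of_le {i : ι} (h : c * k i ≤ 1) : waterFilling k c i = (1 - c * k i) / 2 := by
  rw [waterFilling, max_eq_right (sub_nonneg.2 h)]

theorem waterFilling_of_ge {i : ι} (h : 1 ≤ c * k i) : waterFilling k c i = 0 := by
  rw [waterFilling, max_eq_left (sub_nonpos.2 h), zero_div]

theorem antitone_waterFilling {i : ι} (hi : 0 ≤ k i) : Antitone fun c => waterFilling k c i := by
  intro c d hcd
  simp only [waterFilling]
  gcongr

theorem inv_mul_one_sub_two_mul_waterFilling_le {i : ι} (hi : 0 < k i) :
    (k i)⁻¹ * (1 - 2 * waterFilling k c i) ≤ c := by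
  rw [inv_mul_le_iff₀ hi, waterFilling]
  linarith [le_max_right 0 (1 - c * k i)]

theorem inv_mul_one_sub_two_mul_waterFilling_eq {i : ι} (hi : 0 < k i)
    (hne : waterFilling k c i ≠ 0) : (k i)⁻¹ * (1 - 2 * waterFilling k c i) = c := by
  have hlt := waterFilling_pos_iff.1 ((waterFilling_nonneg k c i).lt_of_ne' hne)
  rw [inv_mul_eq_iff_eq_mul₀ hi.ne', waterFilling_of_le hlt.le]
  ring

variable [Fintype ι]

/-- The multiplier `c` is nonnegative and makes `waterFilling k c` a distribution. The sign
condition is the Karush–Kuhn–Tucker condition at the centre of the star. -/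
structure IsWaterLevel (k : ι → ℝ) (c : ℝ) : Prop where
  nonneg : 0 ≤ c
  sum_eq_one : ∑ i, waterFilling k c i = 1

theorem exists_isWaterLevel (hk : ∀ i, 0 < k i) (hι : 2 ≤ Fintype.card ι) :
    ∃ c, IsWaterLevel k c := by
  have hcont : Continuous fun c => ∑ i, waterFilling k c i := by
    unfold waterFilling
    fun_prop
  have hstart : 1 ≤ ∑ i, waterFilling k 0 i := by
    have : (2 : ℝ) ≤ Fintype.card ι := mod_cast hι
    simp only [waterFilling, zero_mul, sub_zero, max_eq_right zero_le_one, Finset.sum_const,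
      Finset.card_univ, nsmul_eq_mul]
    linarith
  have hinv (i : ι) : 0 ≤ (k i)⁻¹ := (inv_pos.2 (hk i)).le
  have hend : ∑ i, waterFilling k (∑ j, (k j)⁻¹) i = 0 :=
    Finset.sum_eq_zero fun i _ => waterFilling_of_ge <| (inv_le_iff_one_le_mul₀ (hk i)).1 <|
      Finset.single_le_sum (fun j _ => hinv j) (Finset.mem_univ i)
  obtain ⟨c, hc, hsum⟩ := intermediate_value_Icc' (Finset.sum_nonneg fun j _ => hinv j)
    hcont.continuousOn ⟨hend.trans_le zero_le_one, hstart⟩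
  exact ⟨c, hc.1, hsum⟩

theorem sum_waterFilling_lt_sum_waterFilling (hk : ∀ i, 0 < k i) (hcd : c < d)
    (hd : 0 < ∑ i, waterFilling k d i) : ∑ i, waterFilling k d i < ∑ i, waterFilling k c i := by
  obtain ⟨i, hi, hpos⟩ : ∃ i ∈ Finset.univ, 0 < waterFilling k d i :=
    Finset.exists_lt_of_sum_lt (by simpa using hd)
  refine Finset.sum_lt_sum (fun j _ => antitone_waterFilling (hk j).le hcd.le) ⟨i, hi, ?_⟩
  have hlt : c * k i < d * k i := mul_lt_mul_of_pos_right hcd (hk i)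
  have hd1 : d * k i < 1 := waterFilling_pos_iff.1 hpos
  rw [waterFilling_of_le hd1.le, waterFilling_of_le (hlt.trans hd1).le]
  linarith

theorem IsWaterLevel.unique (hk : ∀ i, 0 < k i) (hc : IsWaterLevel k c) (hd : IsWaterLevel k d) :
    c = d := by
  have hsum := hc.sum_eq_one.trans hd.sum_eq_one.symm
  rcases lt_trichotomy c d with h | h | h
  · exact absurd hsum
      (sum_waterFilling_lt_sum_waterFilling hk h (zero_lt_one.trans_eq hd.sum_eq_one.symm)).ne'
  · exact h
  · exact absurd hsum
      (sum_waterFilling_lt_sum_waterFilling hk h (zero_lt_one.trans_eq hc.sum_eq_one.symm)).ne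

end WaterFilling

section Star

variable {n : ℕ} {k : Fin n → ℝ} {c : ℝ} {ℓ : ℕ}

/-- The effective resistances between the centre of the star and its nodes. -/
noncomputable def centreResistance (k : Fin n → ℝ) : Fin (n + 1) → ℝ :=
  Fin.cons 0 fun i => (k i)⁻¹

theorem weightedStar_degree_succ (hk : ∀ i, 0 < k i) (i : Fin n) :
    (weightedStar k hk).degree i.succ = k i := by
  simp [WeightedGraph.degree, weightedStar, Fin.sum_univ_succ]

theorem weightedStar_laplacian_mulVec_single (hk : ∀ i, 0 < k i) (i : Fin (n + 1)) :
    (weightedStar k hk).laplacian *ᵥ Pi.single i (centreResistance k i)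
      = Pi.single i 1 - Pi.single 0 1 := by
  cases i using Fin.cases with
  | zero => simp [centreResistance]
  | succ i =>
    have hi := (hk i).ne'
    ext j
    rw [Matrix.mulVec_single]
    cases j using Fin.cases with
    | zero =>
      simp [WeightedGraph.laplacian, centreResistance, weightedStar, hi, (Fin.succ_ne_zero i).symm]
    | succ j =>
      by_cases hj : j = i
      · subst hj
        simp [WeightedGraph.laplacian, centreResistance, weightedStar_degree_succ, hi]
      · simp [WeightedGraph.laplacian, centreResistance, weightedStar, hj]

theorem weightedStar_resistance (hk : ∀ i, 0 < k i) {i j : Fin (n + 1)} (hij : i ≠ j) :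
    (weightedStar k hk).resistance i j = centreResistance k i + centreResistance k j := by
  have hpotential : (weightedStar k hk).laplacian *ᵥ
      (Pi.single i (centreResistance k i) - Pi.single j (centreResistance k j))
        = Pi.single i 1 - Pi.single j 1 := by
    rw [Matrix.mulVec_sub, weightedStar_laplacian_mulVec_single,
      weightedStar_laplacian_mulVec_single, sub_sub_sub_cancel_right]
  rw [WeightedGraph.resistance_eq_sub_of_laplacian_mulVec _ hpotential]
  simp [hij, hij.symm]

/-- The water filling of the leaves of the star, extended by `0` to the centre. -/
noncomputable def leafDistribution (k : Fin n → ℝ) (c : ℝ) : Fin (n + 1) → ℝ :=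
  Fin.cons 0 (waterFilling k c)

theorem isKKTPoint_leafDistribution (hk : ∀ i, 0 < k i) (hc : IsWaterLevel k c) :
    IsKKTPoint (centreResistance k) (leafDistribution k c) c where
  mem_stdSimplex := by
    refine ⟨Fin.cases le_rfl (waterFilling_nonneg k c), ?_⟩
    simpa [leafDistribution, Fin.sum_univ_succ] using hc.sum_eq_one
  gradient_le := Fin.cases (by simpa [centreResistance] using hc.nonneg)
    fun i => inv_mul_one_sub_two_mul_waterFilling_le (hk i)
  gradient_eq := Fin.cases (fun h => absurd rfl h)
    fun i => inv_mul_one_sub_two_mul_waterFilling_eq (hk i)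

theorem weightedStar_isMaxVariance_iff (hk : ∀ i, 0 < k i) (hc : IsWaterLevel k c)
    {p : Fin (n + 1) → ℝ} :
    (weightedStar k hk).IsMaxVariance p ↔ p = leafDistribution k c := by
  have hnonneg : 0 ≤ centreResistance k := Fin.cases le_rfl fun i => (inv_pos.2 (hk i)).le
  have hzero : {i | centreResistance k i = 0} ⊆ {0} :=
    Fin.cases (fun _ => rfl) fun i hi => absurd hi (inv_ne_zero (hk i).ne')
  rw [WeightedGraph.isMaxVariance_iff_isMaxOn_weightedGiniSimpson fun _ _ =>
    weightedStar_resistance hk]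
  exact (isKKTPoint_leafDistribution hk hc).isMaxOn_weightedGiniSimpson_iff hnonneg
    (Set.subsingleton_singleton.anti hzero)

theorem distSupport_leafDistribution_eq_firstLeaves_iff :
    distSupport (leafDistribution k c) = firstLeaves n ℓ
      ↔ ∀ i : Fin n, (i : ℕ) < ℓ ↔ c * k i < 1 := by
  simp [Set.ext_iff, distSupport, firstLeaves, Fin.forall_fin_succ, leafDistribution,
    waterFilling_pos_iff, Nat.succ_le_iff, iff_comm]

end Star

section SupportIndex

variable {n : ℕ} {k : Fin n → ℝ} {c : ℝ} {ℓ : ℕ}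

theorem partialSum_pos (hk : ∀ i, 0 < k i) (hℓ : 1 ≤ ℓ) (hn : 0 < n) : 0 < partialSum k ℓ :=
  Finset.sum_pos (fun i _ => hk i) ⟨⟨0, hn⟩, by simpa using Nat.lt_of_succ_le hℓ⟩

/-- The inverse `1 / T_ℓ` of the threshold, for `2 ≤ ℓ`; it vanishes at `ℓ = 2`, where
`T_ℓ = +∞`. -/
noncomputable def invThreshold (k : Fin n → ℝ) (ℓ : ℕ) : ℝ := (ℓ - 2) / partialSum k ℓ

theorem invThreshold_nonneg (hk : ∀ i, 0 < k i) (hℓ : 2 ≤ ℓ) : 0 ≤ invThreshold k ℓ :=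
  div_nonneg (sub_nonneg.2 (mod_cast hℓ)) (Finset.sum_nonneg fun i _ => (hk i).le)

theorem coe_lt_threshold_iff (hS : 0 < partialSum k ℓ) (hℓ : 2 ≤ ℓ) {x : ℝ} :
    (x : EReal) < threshold k ℓ ↔ invThreshold k ℓ * x < 1 := by
  rcases hℓ.eq_or_lt with rfl | hlt
  · simp [threshold, invThreshold]
  · have hpos : (0 : ℝ) < ℓ - 2 := sub_pos.2 (mod_cast hlt)
    rw [threshold, if_neg hlt.ne', EReal.coe_lt_coe_iff, lt_inv_mul_iff₀ hpos, invThreshold,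
      div_mul_eq_mul_div, div_lt_one hS]

theorem coe_le_threshold_iff (hS : 0 < partialSum k ℓ) (hℓ : 2 ≤ ℓ) {x : ℝ} :
    (x : EReal) ≤ threshold k ℓ ↔ invThreshold k ℓ * x ≤ 1 := by
  rcases hℓ.eq_or_lt with rfl | hlt
  · simp [threshold, invThreshold]
  · have hpos : (0 : ℝ) < ℓ - 2 := sub_pos.2 (mod_cast hlt)
    rw [threshold, if_neg hlt.ne', EReal.coe_le_coe_iff, le_inv_mul_iff₀ hpos, invThreshold,
      div_mul_eq_mul_div, div_le_one hS]

/-- For `ℓ = 1`, the denominator `ℓ - 2` is negative: `T₁ = -k₁ < k₁`. -/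
theorem two_le_of_coe_le_threshold (hk : ∀ i, 0 < k i) (h1 : 1 ≤ ℓ) (hn : ℓ ≤ n)
    (hle : ∀ i : Fin n, (i : ℕ) + 1 = ℓ → (k i : EReal) ≤ threshold k ℓ) : 2 ≤ ℓ := by
  by_contra! hlt
  obtain rfl : ℓ = 1 := by lia
  have hk0 := hle ⟨0, hn⟩ rfl
  have hneg : (((1 : ℕ) : ℝ) - 2)⁻¹ = -1 := by norm_num
  rw [threshold, if_neg (by norm_num), EReal.coe_le_coe_iff, hneg] at hk0
  linarith [hk ⟨0, hn⟩, partialSum_pos hk le_rfl hn]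

/-- The first `ℓ` leaves contain the support of `waterFilling k c`, and `c kᵢ ≤ 1` on them. Leaves
with `c kᵢ = 1` may lie on either side of the cut, so that `IsSupportIndex` and
`IsWeakSupportIndex` both give one. -/
structure IsCut (k : Fin n → ℝ) (c : ℝ) (ℓ : ℕ) : Prop where
  le : ℓ ≤ n
  mul_le_one : ∀ i : Fin n, (i : ℕ) < ℓ → c * k i ≤ 1
  one_le_mul : ∀ i : Fin n, ℓ ≤ (i : ℕ) → 1 ≤ c * k i

theorem IsCut.waterFilling_apply (h : IsCut k c ℓ) (i : Fin n) :
    waterFilling k c i = if (i : ℕ) < ℓ then (1 - c * k i) / 2 else 0 := by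
  split_ifs with hi
  · exact waterFilling_of_le (h.mul_le_one i hi)
  · exact waterFilling_of_ge (h.one_le_mul i (not_lt.1 hi))

theorem IsCut.sum_waterFilling (h : IsCut k c ℓ) :
    ∑ i, waterFilling k c i = (ℓ - c * partialSum k ℓ) / 2 := by
  simp only [h.waterFilling_apply]
  rw [← Finset.sum_filter, ← Finset.sum_div, Finset.sum_sub_distrib, ← Finset.mul_sum, partialSum,
    Finset.sum_const, Fin.card_filter_val_lt, min_eq_right h.le, nsmul_eq_mul, mul_one]

theorem IsCut.mul_partialSum (h : IsCut k c ℓ) (hc : IsWaterLevel k c) :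
    c * partialSum k ℓ = ℓ - 2 := by
  linarith [h.sum_waterFilling, hc.sum_eq_one]

theorem IsCut.two_le (h : IsCut k c ℓ) (hk : ∀ i, 0 < k i) (hc : IsWaterLevel k c) : 2 ≤ ℓ := by
  have hS : 0 ≤ partialSum k ℓ := Finset.sum_nonneg fun i _ => (hk i).le
  have : (2 : ℝ) ≤ ℓ := by linarith [h.mul_partialSum hc, mul_nonneg hc.nonneg hS]
  exact_mod_cast this

protected theorem IsCut.partialSum_pos (h : IsCut k c ℓ) (hk : ∀ i, 0 < k i)
    (hc : IsWaterLevel k c) : 0 < partialSum k ℓ :=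
  have h2 := h.two_le hk hc
  partialSum_pos hk (one_le_two.trans h2) (two_pos.trans_le (h2.trans h.le))

theorem IsCut.eq_invThreshold (h : IsCut k c ℓ) (hk : ∀ i, 0 < k i) (hc : IsWaterLevel k c) :
    c = invThreshold k ℓ :=
  eq_div_of_mul_eq (h.partialSum_pos hk hc).ne' (h.mul_partialSum hc)

theorem IsCut.starDistribution_eq (h : IsCut k c ℓ) (hk : ∀ i, 0 < k i) (hc : IsWaterLevel k c) :
    starDistribution k ℓ = leafDistribution k c := by
  ext i
  cases i using Fin.cases with
  | zero => rfl
  | succ i =>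
    have hS := (h.partialSum_pos hk hc).ne'
    simp only [starDistribution, leafDistribution, Fin.cons_succ, h.waterFilling_apply]
    rw [h.eq_invThreshold hk hc, invThreshold]
    congr 1
    field_simp

theorem isWaterLevel_invThreshold (hk : ∀ i, 0 < k i) (hℓ : 2 ≤ ℓ)
    (h : IsCut k (invThreshold k ℓ) ℓ) : IsWaterLevel k (invThreshold k ℓ) where
  nonneg := invThreshold_nonneg hk hℓ
  sum_eq_one := by
    have hS := partialSum_pos hk (one_le_two.trans hℓ) (two_pos.trans_le (hℓ.trans h.le))
    rw [h.sum_waterFilling, invThreshold, div_mul_cancel₀ _ hS.ne']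
    norm_num

theorem isCut_of_le_threshold_of_threshold_le (hk : ∀ i, 0 < k i) (hmono : Monotone k)
    (hc : IsWaterLevel k c) (h1 : 1 ≤ ℓ) (hn : ℓ ≤ n)
    (hle : ∀ i : Fin n, (i : ℕ) + 1 = ℓ → (k i : EReal) ≤ threshold k ℓ)
    (hge : ∀ i : Fin n, (i : ℕ) = ℓ → threshold k ℓ ≤ (k i : EReal)) : IsCut k c ℓ := by
  have h2 := two_le_of_coe_le_threshold hk h1 hn hle
  have hS := partialSum_pos hk h1 (h1.trans hn)
  have hcut : IsCut k (invThreshold k ℓ) ℓ := by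
    refine ⟨hn, fun i hi => ?_, fun i hi => ?_⟩
    · have hlast : k i ≤ k ⟨ℓ - 1, by lia⟩ := hmono (Fin.le_def.2 (Nat.le_sub_one_of_lt hi))
      exact (coe_le_threshold_iff hS h2).1
        ((EReal.coe_le_coe_iff.2 hlast).trans (hle _ (Nat.sub_add_cancel h1)))
    · have hnext : k ⟨ℓ, hi.trans_lt i.2⟩ ≤ k i := hmono (Fin.le_def.2 hi)
      rw [← not_lt, ← coe_lt_threshold_iff hS h2, not_lt]
      exact (hge _ rfl).trans (EReal.coe_le_coe_iff.2 hnext)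
  rwa [hc.unique hk (isWaterLevel_invThreshold hk h2 hcut)]

theorem IsSupportIndex.isCut (h : IsSupportIndex k ℓ) (hk : ∀ i, 0 < k i) (hmono : Monotone k)
    (hc : IsWaterLevel k c) : IsCut k c ℓ :=
  isCut_of_le_threshold_of_threshold_le hk hmono hc h.1 h.2.1 (fun i hi => (h.2.2.1 i hi).le)
    h.2.2.2

theorem IsWeakSupportIndex.isCut (h : IsWeakSupportIndex k ℓ) (hk : ∀ i, 0 < k i)
    (hmono : Monotone k) (hc : IsWaterLevel k c) : IsCut k c ℓ :=
  isCut_of_le_threshold_of_threshold_le hk hmono hc h.1 h.2.1 h.2.2.1 fun i hi => (h.2.2.2 i hi).le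

theorem IsWeakSupportIndex.isSupportIndex_iff (h : IsWeakSupportIndex k ℓ) :
    IsSupportIndex k ℓ ↔ ∀ i : Fin n, (i : ℕ) + 1 = ℓ → (k i : EReal) ≠ threshold k ℓ :=
  ⟨fun h' i hi => (h'.2.2.1 i hi).ne, fun hne =>
    ⟨h.1, h.2.1, fun i hi => (h.2.2.1 i hi).lt_of_ne (hne i hi), fun i hi => (h.2.2.2 i hi).le⟩⟩

protected theorem IsCut.coe_lt_threshold_iff (h : IsCut k c ℓ) (hk : ∀ i, 0 < k i)
    (hc : IsWaterLevel k c) {x : ℝ} : (x : EReal) < threshold k ℓ ↔ c * x < 1 := by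
  rw [h.eq_invThreshold hk hc,
    coe_lt_threshold_iff (h.partialSum_pos hk hc) (h.two_le hk hc)]

protected theorem IsCut.coe_le_threshold_iff (h : IsCut k c ℓ) (hk : ∀ i, 0 < k i)
    (hc : IsWaterLevel k c) {x : ℝ} : (x : EReal) ≤ threshold k ℓ ↔ c * x ≤ 1 := by
  rw [h.eq_invThreshold hk hc,
    coe_le_threshold_iff (h.partialSum_pos hk hc) (h.two_le hk hc)]

theorem isSupportIndex_iff (hk : ∀ i, 0 < k i) (hmono : Monotone k) (hc : IsWaterLevel k c) :
    IsSupportIndex k ℓ ↔ ℓ ≤ n ∧ ∀ i : Fin n, (i : ℕ) < ℓ ↔ c * k i < 1 := by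
  constructor
  · intro h
    have hcut := h.isCut hk hmono hc
    refine ⟨h.2.1, fun i => ⟨fun hi => ?_, fun hi => ?_⟩⟩
    · have hlast : k i ≤ k ⟨ℓ - 1, by have := h.2.1; lia⟩ :=
        hmono (Fin.le_def.2 (Nat.le_sub_one_of_lt hi))
      exact (mul_le_mul_of_nonneg_left hlast hc.nonneg).trans_lt
        ((hcut.coe_lt_threshold_iff hk hc).1 (h.2.2.1 _ (Nat.sub_add_cancel h.1)))
    · by_contra! hge
      exact hi.not_ge (hcut.one_le_mul i hge)
  · rintro ⟨hn, hlt⟩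
    have hcut : IsCut k c ℓ :=
      ⟨hn, fun i hi => ((hlt i).1 hi).le, fun i hi => not_lt.1 ((hlt i).not.1 hi.not_gt)⟩
    refine ⟨one_le_two.trans (hcut.two_le hk hc), hn, fun i hi => ?_, fun i hi => ?_⟩
    · exact (hcut.coe_lt_threshold_iff hk hc).2 ((hlt i).1 (by lia))
    · exact not_lt.1 ((hcut.coe_lt_threshold_iff hk hc).not.2 ((hlt i).not.1 hi.not_lt))

theorem isWeakSupportIndex_iff (hk : ∀ i, 0 < k i) (hmono : Monotone k) (hc : IsWaterLevel k c) :
    IsWeakSupportIndex k ℓ ↔ ℓ ≤ n ∧ ∀ i : Fin n, (i : ℕ) < ℓ ↔ c * k i ≤ 1 := by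
  constructor
  · intro h
    have hcut := h.isCut hk hmono hc
    refine ⟨h.2.1, fun i => ⟨hcut.mul_le_one i, fun hi => ?_⟩⟩
    by_contra! hge
    have hnext : k ⟨ℓ, hge.trans_lt i.2⟩ ≤ k i := hmono (Fin.le_def.2 hge)
    exact (h.2.2.2 _ rfl).not_ge ((hcut.coe_le_threshold_iff hk hc).2
      ((mul_le_mul_of_nonneg_left hnext hc.nonneg).trans hi))
  · rintro ⟨hn, hle⟩
    have hcut : IsCut k c ℓ :=
      ⟨hn, fun i => (hle i).1, fun i hi => (not_le.1 ((hle i).not.1 hi.not_gt)).le⟩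
    refine ⟨one_le_two.trans (hcut.two_le hk hc), hn, fun i hi => ?_, fun i hi => ?_⟩
    · exact (hcut.coe_le_threshold_iff hk hc).2 ((hle i).1 (by lia))
    · exact not_le.1 ((hcut.coe_le_threshold_iff hk hc).not.2 ((hle i).not.1 hi.not_lt))

theorem existsUnique_isSupportIndex (hk : ∀ i, 0 < k i) (hmono : Monotone k)
    (hc : IsWaterLevel k c) : ∃! ℓ : ℕ, IsSupportIndex k ℓ := by
  simp only [isSupportIndex_iff hk hmono hc]
  exact existsUnique_forall_val_lt_iff_mem (s := {i | c * k i < 1}) fun _ _ hle hlt =>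
    (mul_le_mul_of_nonneg_left (hmono hle) hc.nonneg).trans_lt hlt

theorem existsUnique_isWeakSupportIndex (hk : ∀ i, 0 < k i) (hmono : Monotone k)
    (hc : IsWaterLevel k c) : ∃! ℓ : ℕ, IsWeakSupportIndex k ℓ := by
  simp only [isWeakSupportIndex_iff hk hmono hc]
  exact existsUnique_forall_val_lt_iff_mem (s := {i | c * k i ≤ 1}) fun _ _ hle hle' =>
    (mul_le_mul_of_nonneg_left (hmono hle) hc.nonneg).trans hle'

theorem distSupport_leafDistribution_eq_firstLeaves_iff_isSupportIndex (hk : ∀ i, 0 < k i)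
    (hmono : Monotone k) (hc : IsWaterLevel k c) (hn : ℓ ≤ n) :
    distSupport (leafDistribution k c) = firstLeaves n ℓ ↔ IsSupportIndex k ℓ := by
  rw [distSupport_leafDistribution_eq_firstLeaves_iff, isSupportIndex_iff hk hmono hc,
    and_iff_right hn]

end SupportIndex

theorem mainTheorem4 (n : ℕ) (hn : 2 ≤ n) (k : Fin n → ℝ) (hk : ∀ i, 0 < k i)
    (hmono : Monotone k) :
    (∃! p : Fin (n + 1) → ℝ, (weightedStar k hk).IsMaxVariance p) ∧
    (∃! ℓ : ℕ, IsSupportIndex k ℓ) ∧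
    (∃! ℓ : ℕ, IsWeakSupportIndex k ℓ) ∧
    ∀ p : Fin (n + 1) → ℝ, (weightedStar k hk).IsMaxVariance p →
      (∀ ℓ : ℕ, IsSupportIndex k ℓ →
        distSupport p = firstLeaves n ℓ ∧ p = starDistribution k ℓ) ∧
      (∀ ℓ : ℕ, IsWeakSupportIndex k ℓ →
        p = starDistribution k ℓ ∧
        (distSupport p = firstLeaves n ℓ ↔
          ∀ i : Fin n, (i : ℕ) + 1 = ℓ → (k i : EReal) ≠ threshold k ℓ)) := by
  obtain ⟨c, hc⟩ := exists_isWaterLevel hk (hn.trans_eq (Fintype.card_fin n).symm)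
  have hmax (p) : (weightedStar k hk).IsMaxVariance p ↔ p = leafDistribution k c :=
    weightedStar_isMaxVariance_iff hk hc
  have hsupport {ℓ : ℕ} (hℓ : ℓ ≤ n) :=
    distSupport_leafDistribution_eq_firstLeaves_iff_isSupportIndex hk hmono hc hℓ
  refine ⟨by simp only [hmax, existsUnique_eq], existsUnique_isSupportIndex hk hmono hc,
    existsUnique_isWeakSupportIndex hk hmono hc, fun p hp => ?_⟩
  obtain rfl := (hmax p).1 hp
  refine ⟨fun ℓ h => ?_, fun ℓ h => ?_⟩
  · exact ⟨(hsupport h.2.1).2 h, ((h.isCut hk hmono hc).starDistribution_eq hk hc).symm⟩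
  · exact ⟨((h.isCut hk hmono hc).starDistribution_eq hk hc).symm,
      (hsupport h.2.1).trans h.isSupportIndex_iff⟩
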